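/- **Setting.** Hilbert spaces are complex and separable, possibly infinite-dimensional; $H\otimes A$ is the Hilbert tensor product. A *density operator* on $K$ is a nonzero, positive semidefinite, trace-class operator (not necessarily of trace $1$); it is *pure* if it equals $|\psi\rangle\langle\psi|$ for some nonzero vector $\psi$. A *measurement* over $K$ is a countable family $(L_i)_{i\in I}$ of bounded operators on $K$ with $\sum_{i\in I}L_i^\dagger L_i=\mathrm{Id}$ in the weak operator topology; in state $\sigma$ it produces outcome $i$ with probability $\mathrm{Tr}(L_i\sigma L_i^\dagger)/\mathrm{Tr}(\sigma)$ and post-measurement state $L_i\sigma L_i^\dagger$. A *measurement tree* over $K$ is a rooted tree with a finite bound on the lengths of its branches, in which every non-leaf node carries a measurement over $K$ and the edges to its children are labeled one-to-one by the outcomes of that measurement. For a branch $\beta=(o_1,\dots,o_N)$ (from the root to a leaf), let $A_n$ be the measurement operator producing $o_n$ at the $n$-th node of $\beta$. The *cumulative operator* is $C_\beta=A_N\circ\cdots\circ A_1$ (with $C_\beta=\mathrm{Id}$ if $N=0$). The probability $P(\beta\mid\sigma)$ that the computation on input $\sigma$ follows $\beta$ is the product $p_1\cdots p_N$, where $p_n$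 is the probability of outcome $o_n$ in the state reached after the first $n-1$ measurements (the product is $0$ as soon as one factor is $0$); $\beta$ is *attainable* on $\sigma$ if $P(\beta\mid\sigma)>0$. **Theorem 4.1.** Let $H$ and $A$ be Hilbert spaces with $\dim H\ge 2$, let $|a\rangle\in A$ be a unit vector, let $U$ be a unitary operator on $H$, and let $T$ be a measurement tree over $H\otimes A$ with a branch $\beta$. Suppose that $T$ computes $U$ along $\beta$ on all pure inputs, that is, for every pure density operator $\rho$ on $H$, the partial trace $\mathrm{Tr}_A\big(C_\beta(\rho\otimes|a\rangle\langle a|)C_\beta^\dagger\big)$ is a scalar multiple (possibly zero) of $U\rho U^\dagger$. Then there is a vector $b\in A$ such that, for all density operators $\rho$ on $H$ (pure or not): 1. $C_\beta(\rho\otimes|a\rangle\langle a|)C_\beta^\dagger=U\rho U^\dagger\otimes|b\rangle\langle b|$; 2. $P(\beta\mid\rho\otimes|a\rangle\langle a|)=\mathrm{Tr}(|b\rangle\langle b|)=\|b\|^2$, which is independent of $\rho$; 3. if $\beta$ is attainable on $\rho'\otimes|a\rangle\langle a|$ for some density operator $\rho'$ on $H$, then it is attainable on $\rho\otimes|a\rangle\langle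 a|$. -/

import Mathlib

noncomputable section

namespace MeasurementTree

open scoped TensorProduct

/-! ### Orthonormal bases, traces, density operators -/

section Trace

variable (E : Type*) [NormedAddCommGroup E] [InnerProductSpace ℂ E] [CompleteSpace E]

/-- The underlying set of some orthonormal basis of the Hilbert space `E`. -/
def stdBasisSet : Set E := (exists_hilbertBasis ℂ E).choose

/-- Some orthonormal basis (in the Hilbert space sense) of `E`, fixed once and for all. -/
def stdBasis : HilbertBasis (stdBasisSet E) ℂ E := (exists_hilbertBasis ℂ E).choose_spec.choose

end Trace

variable {E : Type*} [NormedAddCommGroup E] [InnerProductSpace ℂ E] [CompleteSpace E]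

/-- The trace `∑ i, ⟨e i, T (e i)⟩` of a trace-class operator; for the positive operators used below
it does not depend on the orthonormal basis `e`, see `hasSum_trace`. -/
def trace (T : E →L[ℂ] E) : ℂ := ∑' i, inner ℂ (stdBasis E i) (T (stdBasis E i))

theorem tsum_enorm_inner_sq {ι E : Type*} [NormedAddCommGroup E]
    [InnerProductSpace ℂ E] (e : HilbertBasis ι ℂ E) (x : E) :
    ∑' i, (‖inner ℂ (e i) x‖ₑ ^ 2) = ‖x‖ₑ ^ 2 := by
  have h := e.hasSum_inner_mul_inner x x
  have h1 : HasSum (fun i => ‖inner ℂ (e i) x‖ ^ 2) (‖x‖ ^ 2) := by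
    have := (Complex.hasSum_re h)
    convert this using 2
    · rw [← inner_conj_symm x, RCLike.conj_mul]; norm_cast
    · rw [← inner_self_eq_norm_sq (𝕜 := ℂ)]; rfl
  have h2 := ENNReal.ofReal_tsum_of_nonneg (fun i => by positivity) h1.summable
  rw [h1.tsum_eq] at h2
  simp_rw [ENNReal.ofReal_pow (norm_nonneg _), ofReal_norm] at h2
  exact h2.symm

theorem tsum_enorm_sq_basis {ι κ : Type*} (e : HilbertBasis ι ℂ E) (f : HilbertBasis κ ℂ E)
    (S : E →L[ℂ] E) (hS : IsSelfAdjoint S) : ∑' i, ‖S (e i)‖ₑ ^ 2 = ∑' j, ‖S (f j)‖ₑ ^ 2 := by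
  simp_rw [← tsum_enorm_inner_sq f (S (e _)), ← tsum_enorm_inner_sq e (S (f _))]
  rw [ENNReal.tsum_comm]
  refine tsum_congr fun j => tsum_congr fun i => ?_
  rw [← ContinuousLinearMap.adjoint_inner_left, hS.adjoint_eq, ← inner_conj_symm]
  rw [← ofReal_norm, ← ofReal_norm, RCLike.norm_conj]

theorem hasSum_norm_sq_iff {κ E : Type*} [NormedAddCommGroup E] (g : κ → E) (t : ℝ) (ht : 0 ≤ t) :
    HasSum (fun i => ‖g i‖ ^ 2) t ↔ ∑' i, ‖g i‖ₑ ^ 2 = ENNReal.ofReal t := by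
  have e1 : ∀ i, ‖g i‖ₑ ^ 2 = ((‖g i‖₊ ^ 2 : NNReal) : ENNReal) := fun i => by
    push_cast; rfl
  simp_rw [e1]
  rw [← ENNReal.summable.hasSum_iff]
  lift t to NNReal using ht
  rw [ENNReal.ofReal_coe_nnreal, ENNReal.hasSum_coe, ← NNReal.hasSum_coe]
  simp

/-- The trace of a positive operator of finite trace does not depend on the orthonormal basis. -/
theorem hasSum_trace {ρ : E →L[ℂ] E} (hpos : ρ.IsPositive)
    (hsum : Summable fun i => inner ℂ (stdBasis E i) (ρ (stdBasis E i))) {ι : Type*} (f : HilbertBasis ι ℂ E) :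
    HasSum (fun i => inner ℂ (f i) (ρ (f i))) (trace ρ) := by
  obtain ⟨S, hS, rfl⟩ : ∃ S : E →L[ℂ] E, IsSelfAdjoint S ∧ ρ = S * S :=
    ⟨CFC.sqrt ρ, (CFC.sqrt_nonneg ρ).isSelfAdjoint, (CFC.sqrt_mul_sqrt_self ρ
      ((ContinuousLinearMap.nonneg_iff_isPositive ρ).2 hpos)).symm⟩
  have key (x : E) : inner ℂ x ((S * S) x) = ((‖S x‖ ^ 2 : ℝ) : ℂ) := by
    rw [mul_apply_eq_comp, ← ContinuousLinearMap.adjoint_inner_left, hS.adjoint_eq,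
      inner_self_eq_norm_sq_to_K]; simp
  unfold trace
  simp_rw [key] at hsum ⊢
  rw [← Complex.ofReal_tsum, Complex.hasSum_ofReal, hasSum_norm_sq_iff _ _ (tsum_nonneg fun i => by positivity),
    tsum_enorm_sq_basis f (stdBasis E) S hS, ← hasSum_norm_sq_iff _ _ (tsum_nonneg fun i => by positivity)]
  exact (Complex.summable_ofReal.1 hsum).hasSum

/-- A density operator: a nonzero, positive semidefinite (in particular Hermitian) bounded operator
of finite trace. It need not be normalized. -/
structure IsDensity (ρ : E →L[ℂ] E) : Prop where
  ne_zero : ρ ≠ 0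
  isPositive : ρ.IsPositive
  summable : Summable fun i => inner ℂ (stdBasis E i) (ρ (stdBasis E i))

/-- A pure density operator: `ρ = |ψ⟩⟨ψ|` for a nonzero, not necessarily normalized, `ψ`. -/
def IsPure (ρ : E →L[ℂ] E) : Prop := ∃ ψ : E, ψ ≠ 0 ∧ ρ = InnerProductSpace.rankOne ℂ ψ ψ

/-! ### The Hilbert tensor product, tensor products of operators, the partial trace -/

/-- The tensor product `H ⊗ A` of Hilbert spaces: the completion of the algebraic tensor product
for the inner product with `⟨x ⊗ y, x' ⊗ y'⟩ = ⟨x, x'⟩ ⟨y, y'⟩`. -/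
abbrev HTensor (H A : Type*) [NormedAddCommGroup H] [InnerProductSpace ℂ H]
    [NormedAddCommGroup A] [InnerProductSpace ℂ A] : Type _ :=
  UniformSpace.Completion (H ⊗[ℂ] A)

variable {H A : Type*} [NormedAddCommGroup H] [InnerProductSpace ℂ H] [CompleteSpace H]
  [NormedAddCommGroup A] [InnerProductSpace ℂ A] [CompleteSpace A]

/-- The tensor product `S ⊗ T` of bounded operators. -/
def opTensor (S : H →L[ℂ] H) (T : A →L[ℂ] A) : HTensor H A →L[ℂ] HTensor H A :=
  (TensorProduct.mapL S T).completion

/-- The map `x ↦ x ⊗ y` from `H` to `H ⊗ A`. -/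
def tensorKet (H : Type*) [NormedAddCommGroup H] [InnerProductSpace ℂ H] (y : A) :
    H →L[ℂ] HTensor H A :=
  UniformSpace.Completion.toComplL ∘L (TensorProduct.mkL ℂ H A).flip y

/-- The partial trace over `A` of a trace-class operator `T` on `H ⊗ A`, the sum
`∑ j, (1 ⊗ ⟨f j|) T (1 ⊗ |f j⟩)` over an orthonormal basis `f` of `A`, which converges in the
weak operator topology. -/
def partialTrace (T : HTensor H A →L[ℂ] HTensor H A) : H →L[ℂ] H :=
  (∑' j, ContinuousLinearMapWOT.ofCLM ((tensorKet H (stdBasis A j)).adjoint ∘L T ∘L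
    tensorKet H (stdBasis A j)) : H →WOT[ℂ] H).toCLM

/-- The full input `ρ ⊗ |a⟩⟨a|` for the principal input `ρ` and the ancilla state `a`. -/
def fullInput (a : A) (ρ : H →L[ℂ] H) : HTensor H A →L[ℂ] HTensor H A :=
  opTensor ρ (InnerProductSpace.rankOne ℂ a a)

/-! ### Measurements and measurement trees over a Hilbert space -/

section Tree

universe u v

/-- A (general) measurement over `K`: a countable family of bounded operators `L i`, indexed by the
classical outcomes, with `∑ i, (L i)† (L i) = 1` in the weak operator topology. -/
structure Measurement (K : Type u) [NormedAddCommGroup K] [InnerProductSpace ℂ K]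
    [CompleteSpace K] : Type (max u (v + 1)) where
  Outcome : Type v
  countable : Countable Outcome
  op : Outcome → K →L[ℂ] K
  hasSum : HasSum (fun i => ContinuousLinearMapWOT.ofCLM ((op i).adjoint ∘L op i))
    (1 : K →WOT[ℂ] K)

/-- Rooted trees, all of whose branches are finite, in which every non-leaf node carries a
measurement over `K` and has exactly one child for each outcome of that measurement. -/
inductive MTree (K : Type u) [NormedAddCommGroup K] [InnerProductSpace ℂ K]
    [CompleteSpace K] : Type (max u (v + 1)) where
  | leaf : MTree K
  | node (M : Measurement.{u, v} K) (child : M.Outcome → MTree K) : MTree K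

variable {K : Type u} [NormedAddCommGroup K] [InnerProductSpace ℂ K] [CompleteSpace K]

/-- The branches `(o₁, …, o_N)` of a tree: sequences of outcomes leading from the root to a leaf. -/
inductive Branch : MTree.{u, v} K → Type (max u (v + 1)) where
  | nil : Branch MTree.leaf
  | cons {M : Measurement.{u, v} K} {child : M.Outcome → MTree.{u, v} K} (o : M.Outcome)
      (β : Branch (child o)) : Branch (MTree.node M child)

/-- The number of edges of a branch. -/
def Branch.length : {T : MTree.{u, v} K} → Branch T → ℕ
  | _, .nil => 0
  | _, .cons _ β => β.length + 1

/-- A tree is a measurement tree if there is a finite bound on the lengths of its branches. -/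
def IsMeasTree (T : MTree.{u, v} K) : Prop := ∃ N : ℕ, ∀ β : Branch T, β.length ≤ N

/-- The cumulative operator `A_N ∘ ⋯ ∘ A_1` of a branch `(o₁, …, o_N)`, where `A_n` is the
measurement operator that produces the outcome `o_n`. -/
def Branch.cumOp : {T : MTree.{u, v} K} → Branch T → K →L[ℂ] K
  | _, .nil => ContinuousLinearMap.id ℂ K
  | _, .cons (M := M) o β => β.cumOp ∘L M.op o

/-- The post-measurement state `L σ L†` of a measurement in state `σ` with outcome `o`. -/
def Measurement.post (M : Measurement.{u, v} K) (o : M.Outcome) (σ : K →L[ℂ] K) : K →L[ℂ] K :=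
  M.op o ∘L σ ∘L (M.op o).adjoint

/-- The probability `Tr (L σ L†) / Tr σ` of the outcome `o` of a measurement in state `σ`. -/
def Measurement.prob (M : Measurement.{u, v} K) (o : M.Outcome) (σ : K →L[ℂ] K) : ℝ :=
  (trace (M.post o σ)).re / (trace σ).re

/-- The probability `p₁ ⋯ p_N` that the computation on input `σ` follows the given branch, where
`p_n` is the probability of the `n`-th outcome in the state reached before the `n`-th measurement.
(If that state is the zero operator, then an earlier factor is zero already.) -/
def Branch.prob : {T : MTree.{u, v} K} → Branch T → (K →L[ℂ] K) → ℝ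
  | _, .nil, _ => 1
  | _, .cons (M := M) o β, σ => M.prob o σ * β.prob (M.post o σ)

/-- A branch is attainable on input `σ` if it is followed with positive probability. -/
def Branch.Attainable {T : MTree.{u, v} K} (β : Branch T) (σ : K →L[ℂ] K) : Prop := 0 < β.prob σ

end Tree

/-- The tree `T` computes `U` on principal input `ρ` along the branch `β`: with `C` the cumulative
operator of `β`, the operator `Tr_A (C (ρ ⊗ |a⟩⟨a|) C†)` agrees with `U ρ U†` up to a scalar factor.
The factor may be zero, so that `β` is not presupposed to be attainable. -/
def ComputesAlong {T : MTree (HTensor H A)} (β : Branch T) (a : A) (U : H →L[ℂ] H)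
    (ρ : H →L[ℂ] H) : Prop :=
  ∃ c : ℂ, partialTrace (β.cumOp ∘L fullInput a ρ ∘L β.cumOp.adjoint) =
    c • (U ∘L ρ ∘L U.adjoint)

end MeasurementTree

end

/-!
Write `C` for the cumulative operator, `D ψ = C (ψ ⊗ a)`, and `f` for an orthonormal basis of `A`.
For a pure input `|ψ⟩⟨ψ|` the partial trace is `∑ j, |w j⟩⟨w j|` with `w j = (1 ⊗ ⟨f j|) D ψ`. It
converges in norm by Bessel's inequality (`hasSum_partialTrace_rankOne`), so its value is meaningful,
and a sum of positive operators supported on the line of `U ψ` has all its summands supported there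
(`mem_span_of_hasSum_rankOne`). Thus every vector is an eigenvector of the bounded operator
`U† (1 ⊗ ⟨f j|) D` on `H`, which is therefore a scalar `c j`. The `c j` are the coordinates of a
vector `b` with `D ψ = U ψ ⊗ b` for all `ψ` (`exists_eq_tensorKet_comp`).

Since `ρ ⊗ |a⟩⟨a|` is the conjugate of `ρ` by `ψ ↦ ψ ⊗ a` (`opTensor_rankOne`), the final state is
`D ρ D† = U ρ U† ⊗ |b⟩⟨b|`, for mixed `ρ` too. The probability of the branch telescopes to
`Tr (D ρ D†) / Tr ρ` (`Branch.prob_eq`), and this is `‖b‖²` because `D` is `‖b‖` times an isometry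
(`IsPosTraceClass.trace_conj`). The traces are computed by factoring `ρ = S S†` and using that an
operator and its adjoint have the same Hilbert–Schmidt norm (`tsum_enorm_sq_adjoint`).
-/

namespace MeasurementTree

open scoped TensorProduct

/-! ### Elementary tensors in the Hilbert tensor product -/

section Tensor

variable {H A : Type*} [NormedAddCommGroup H] [InnerProductSpace ℂ H]
  [NormedAddCommGroup A] [InnerProductSpace ℂ A]

theorem tensorKet_apply (y : A) (x : H) :
    tensorKet H y x = ((x ⊗ₜ[ℂ] y : H ⊗[ℂ] A) : HTensor H A) := rfl

theorem inner_tensorKet (y y' : A) (x x' : H) :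
    inner ℂ (tensorKet H y x) (tensorKet H y' x') = inner ℂ x x' * inner ℂ y y' := by
  simp [tensorKet_apply]

theorem norm_tensorKet (y : A) (x : H) : ‖tensorKet H y x‖ = ‖x‖ * ‖y‖ := by
  simp [tensorKet_apply]

theorem clm_ext_tensorKet {G : Type*} [NormedAddCommGroup G] [NormedSpace ℂ G]
    {S T : HTensor H A →L[ℂ] G} (h : ∀ x y, S (tensorKet H y x) = T (tensorKet H y x)) :
    S = T := by
  ext u
  induction u using UniformSpace.Completion.induction_on with
  | hp => exact isClosed_eq S.continuous T.continuous
  | ih u =>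
    induction u using TensorProduct.induction_on with
    | zero => rw [UniformSpace.Completion.coe_zero, map_zero, map_zero]
    | tmul x y => exact h x y
    | add u v hu hv => rw [UniformSpace.Completion.coe_add, map_add, map_add, hu, hv]

theorem ext_inner_tensorKet {u v : HTensor H A}
    (h : ∀ x y, inner ℂ u (tensorKet H y x) = inner ℂ v (tensorKet H y x)) : u = v :=
  (innerSL_inj (𝕜 := ℂ)).1 (clm_ext_tensorKet h)

variable [CompleteSpace H]

theorem adjoint_tensorKet_apply (b y : A) (x : H) :
    (tensorKet H b).adjoint (tensorKet H y x) = inner ℂ b y • x := by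
  refine ext_inner_left ℂ fun z => ?_
  rw [ContinuousLinearMap.adjoint_inner_right, inner_tensorKet, inner_smul_right, mul_comm]

variable [CompleteSpace A]

omit [CompleteSpace H] [CompleteSpace A] in
theorem opTensor_tensorKet (S : H →L[ℂ] H) (T : A →L[ℂ] A) (x : H) (y : A) :
    opTensor S T (tensorKet H y x) = tensorKet H (T y) (S x) := by
  rw [opTensor, tensorKet_apply, ContinuousLinearMap.completion_apply_coe,
    TensorProduct.mapL_tmul, tensorKet_apply]

omit [CompleteSpace A] in
/-- `S ⊗ |b⟩⟨b|` is the conjugate of `S` by the map `x ↦ x ⊗ b`. -/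
theorem opTensor_rankOne (S : H →L[ℂ] H) (b : A) :
    opTensor S (InnerProductSpace.rankOne ℂ b b) =
      tensorKet H b ∘L S ∘L (tensorKet H b).adjoint := by
  refine clm_ext_tensorKet fun x y => ?_
  rw [opTensor_tensorKet]
  simp only [ContinuousLinearMap.comp_apply, adjoint_tensorKet_apply,
    InnerProductSpace.rankOne_apply, map_smul]
  simp [tensorKet_apply, TensorProduct.tmul_smul, UniformSpace.Completion.coe_smul]

/-! ### The partial trace of a pure state -/

omit [CompleteSpace A] in
/-- Bessel's inequality for the family of orthogonal subspaces `H ⊗ f j` of `H ⊗ A`. -/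
theorem sum_norm_sq_adjoint_tensorKet_le {ι : Type*} {f : ι → A} (hf : Orthonormal ℂ f)
    (v : HTensor H A) (s : Finset ι) :
    ∑ j ∈ s, ‖(tensorKet H (f j)).adjoint v‖ ^ 2 ≤ ‖v‖ ^ 2 := by
  classical
  set w : HTensor H A := ∑ j ∈ s, tensorKet H (f j) ((tensorKet H (f j)).adjoint v) with hw
  have h (u : HTensor H A) (hu : ∀ j ∈ s, (tensorKet H (f j)).adjoint u =
      (tensorKet H (f j)).adjoint v) :
      inner ℂ u w = ((∑ j ∈ s, ‖(tensorKet H (f j)).adjoint v‖ ^ 2 : ℝ) : ℂ) := by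
    rw [hw, inner_sum, Complex.ofReal_sum]
    refine Finset.sum_congr rfl fun j hj => ?_
    rw [← ContinuousLinearMap.adjoint_inner_left, hu j hj, inner_self_eq_norm_sq_to_K]
    simp
  have hvw := h v fun _ _ => rfl
  have hww := h w fun j hj => by
    rw [hw, map_sum]
    simp_rw [adjoint_tensorKet_apply, orthonormal_iff_ite.1 hf, ite_smul, one_smul, zero_smul]
    simp [hj]
  rw [inner_self_eq_norm_sq_to_K] at hww
  have hww' : ‖w‖ ^ 2 = ∑ j ∈ s, ‖(tensorKet H (f j)).adjoint v‖ ^ 2 := by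
    apply Complex.ofReal_injective
    rw [← hww]
    simp
  rw [← hww'] at hvw ⊢
  have hle := norm_inner_le_norm (𝕜 := ℂ) v w
  rw [hvw, Complex.norm_real, Real.norm_of_nonneg (by positivity)] at hle
  nlinarith [sq_nonneg (‖v‖ - ‖w‖)]

/-- The series of the partial trace of `|v⟩⟨v|` converges even in norm. -/
theorem hasSum_partialTrace_rankOne (v : HTensor H A) :
    HasSum (fun j => InnerProductSpace.rankOne ℂ ((tensorKet H (stdBasis A j)).adjoint v)
        ((tensorKet H (stdBasis A j)).adjoint v))
      (partialTrace (InnerProductSpace.rankOne ℂ v v)) := by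
  set g := fun j => InnerProductSpace.rankOne ℂ ((tensorKet H (stdBasis A j)).adjoint v)
        ((tensorKet H (stdBasis A j)).adjoint v) with hg
  have hs : Summable g := by
    refine Summable.of_norm ?_
    simp only [hg, InnerProductSpace.norm_rankOne, ← sq]
    exact summable_of_sum_le (fun _ => by positivity)
      (sum_norm_sq_adjoint_tensorKet_le (stdBasis A).orthonormal v)
  have hW : HasSum (fun j => ContinuousLinearMapWOT.ofCLM (g j))
      (ContinuousLinearMapWOT.ofCLM (∑' j, g j)) :=
    hs.hasSum.map (ContinuousLinearMapWOT.linearEquiv (σ := RingHom.id ℂ) (E := H) (F := H) ℂ).symm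
      ContinuousLinearMapWOT.continuous_ofCLM
  have hg' (j) : (tensorKet H (stdBasis A j)).adjoint ∘L InnerProductSpace.rankOne ℂ v v ∘L
      tensorKet H (stdBasis A j) = g j := by
    rw [InnerProductSpace.rankOne_comp, InnerProductSpace.comp_rankOne]
  have hp : partialTrace (InnerProductSpace.rankOne ℂ v v) = ∑' j, g j := by
    unfold partialTrace
    rw [tsum_congr fun j => congrArg ContinuousLinearMapWOT.ofCLM (hg' j), hW.tsum_eq]
  rw [hp]
  exact hs.hasSum

omit [CompleteSpace H] in
/-- A convergent sum of rank-one projections can be a multiple of `|φ⟩⟨φ|` only if every summand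
is: for `x ⊥ φ`, the sum of `|⟨w j, x⟩|²` vanishes. -/
theorem mem_span_of_hasSum_rankOne {ι : Type*} {w : ι → H} {φ : H} {c : ℂ}
    (h : HasSum (fun j => InnerProductSpace.rankOne ℂ (w j) (w j))
      (c • InnerProductSpace.rankOne ℂ φ φ)) (j : ι) : w j ∈ Submodule.span ℂ {φ} := by
  rw [← Submodule.orthogonal_orthogonal (Submodule.span ℂ {φ})]
  intro x hx
  rw [Submodule.mem_orthogonal_singleton_iff_inner_right] at hx
  have h1 := (h.mapL (ContinuousLinearMap.apply ℂ H x)).mapL (innerSL ℂ x)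
  have h2 : HasSum (fun j => ‖(inner ℂ x (w j) : ℂ)‖ ^ 2) 0 := by
    have h0 : innerSL ℂ x (ContinuousLinearMap.apply ℂ H x
        (c • InnerProductSpace.rankOne ℂ φ φ)) = ((0 : ℝ) : ℂ) := by
      simp [ContinuousLinearMap.apply_apply, hx]
    rw [h0] at h1
    refine Complex.hasSum_ofReal.1 (h1.congr_fun fun i => ?_)
    have hi : inner ℂ (w i) x * inner ℂ x (w i) = (‖(inner ℂ x (w i) : ℂ)‖ ^ 2 : ℂ) := by
      rw [← inner_conj_symm (w i) x, Complex.conj_mul']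
    simpa [inner_smul_right] using hi.symm
  have := (hasSum_zero_iff_of_nonneg fun _ => by positivity).1 h2
  simpa using congrFun this j

end Tensor

/-! ### Traces of conjugated positive operators -/

section Trace

variable {E F : Type*} [NormedAddCommGroup E] [InnerProductSpace ℂ E] [CompleteSpace E]
  [NormedAddCommGroup F] [InnerProductSpace ℂ F] [CompleteSpace F]

/-- A bounded operator between Hilbert spaces and its adjoint have the same Hilbert–Schmidt norm. -/
theorem tsum_enorm_sq_adjoint {ι κ : Type*} (e : HilbertBasis ι ℂ E) (f : HilbertBasis κ ℂ F)
    (R : E →L[ℂ] F) : ∑' j, ‖R.adjoint (f j)‖ₑ ^ 2 = ∑' i, ‖R (e i)‖ₑ ^ 2 := by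
  simp_rw [← tsum_enorm_inner_sq f (R (e _)), ← tsum_enorm_inner_sq e (R.adjoint (f _))]
  rw [ENNReal.tsum_comm]
  refine tsum_congr fun i => tsum_congr fun j => ?_
  rw [ContinuousLinearMap.adjoint_inner_right, ← inner_conj_symm, ← ofReal_norm, ← ofReal_norm,
    RCLike.norm_conj]

theorem hasSum_norm_sq_adjoint {ι κ : Type*} (e : HilbertBasis ι ℂ E) (f : HilbertBasis κ ℂ F)
    {R : E →L[ℂ] F} {t : ℝ} (h : HasSum (fun i => ‖R (e i)‖ ^ 2) t) :
    HasSum (fun j => ‖R.adjoint (f j)‖ ^ 2) t := by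
  have ht : 0 ≤ t := h.nonneg fun _ => by positivity
  rw [hasSum_norm_sq_iff _ _ ht] at h ⊢
  rw [tsum_enorm_sq_adjoint e f, h]

/-- A positive operator of finite trace; unlike a density operator, it may be zero. -/
structure IsPosTraceClass (ρ : E →L[ℂ] E) : Prop where
  isPositive : ρ.IsPositive
  summable : Summable fun i => inner ℂ (stdBasis E i) (ρ (stdBasis E i))

theorem IsDensity.isPosTraceClass {ρ : E →L[ℂ] E} (h : IsDensity ρ) : IsPosTraceClass ρ :=
  ⟨h.isPositive, h.summable⟩

theorem inner_comp_adjoint (R : E →L[ℂ] F) (x : F) :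
    inner ℂ x ((R ∘L R.adjoint) x) = ((‖R.adjoint x‖ ^ 2 : ℝ) : ℂ) := by
  rw [ContinuousLinearMap.comp_apply, ← ContinuousLinearMap.adjoint_inner_left,
    inner_self_eq_norm_sq_to_K]
  simp

theorem IsPosTraceClass.exists_sqrt {ρ : E →L[ℂ] E} (h : IsPosTraceClass ρ) :
    ∃ S : E →L[ℂ] E, ρ = S ∘L S.adjoint ∧
      HasSum (fun i => ‖S (stdBasis E i)‖ ^ 2) (trace ρ).re := by
  have hS : IsSelfAdjoint (CFC.sqrt ρ) := (CFC.sqrt_nonneg ρ).isSelfAdjoint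
  have hρ : ρ = CFC.sqrt ρ ∘L (CFC.sqrt ρ).adjoint := by
    rw [hS.adjoint_eq]
    exact (CFC.sqrt_mul_sqrt_self ρ
      ((ContinuousLinearMap.nonneg_iff_isPositive ρ).2 h.isPositive)).symm
  refine ⟨CFC.sqrt ρ, hρ, ?_⟩
  refine (Complex.hasSum_re h.summable.hasSum).congr_fun fun i => ?_
  conv_rhs => rw [hρ]
  rw [inner_comp_adjoint, hS.adjoint_eq, Complex.ofReal_re]

theorem isPosTraceClass_comp_adjoint {R : E →L[ℂ] F} {t : ℝ}
    (h : HasSum (fun i => ‖R (stdBasis E i)‖ ^ 2) t) :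
    IsPosTraceClass (R ∘L R.adjoint) ∧ trace (R ∘L R.adjoint) = t := by
  have hs := Complex.hasSum_ofReal.2 (hasSum_norm_sq_adjoint _ (stdBasis F) h)
  simp_rw [← inner_comp_adjoint] at hs
  exact ⟨⟨ContinuousLinearMap.isPositive_self_comp_adjoint R, hs.summable⟩, hs.tsum_eq⟩

theorem IsPosTraceClass.conj {ρ : E →L[ℂ] E} (h : IsPosTraceClass ρ) (V : E →L[ℂ] F) :
    IsPosTraceClass (V ∘L ρ ∘L V.adjoint) := by
  obtain ⟨S, hρ, hS⟩ := h.exists_sqrt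
  have hV : Summable fun i => ‖(V ∘L S) (stdBasis E i)‖ ^ 2 :=
    Summable.of_nonneg_of_le (fun _ => by positivity)
      (fun i => (pow_le_pow_left₀ (norm_nonneg _) (V.le_opNorm _) 2).trans_eq (mul_pow _ _ _))
      (hS.summable.mul_left (‖V‖ ^ 2))
  have := (isPosTraceClass_comp_adjoint hV.hasSum).1
  rw [hρ]
  rwa [ContinuousLinearMap.adjoint_comp] at this

/-- Conjugation by a multiple of an isometry multiplies the trace by the square of the factor. -/
theorem IsPosTraceClass.trace_conj {ρ : E →L[ℂ] E} (h : IsPosTraceClass ρ) {V : E →L[ℂ] F}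
    {t : ℝ} (hV : ∀ x, ‖V x‖ = t * ‖x‖) :
    trace (V ∘L ρ ∘L V.adjoint) = ((t ^ 2 * (trace ρ).re : ℝ) : ℂ) := by
  obtain ⟨S, hρ, hS⟩ := h.exists_sqrt
  have hs : HasSum (fun i => ‖(V ∘L S) (stdBasis E i)‖ ^ 2) (t ^ 2 * (trace ρ).re) := by
    simp_rw [ContinuousLinearMap.comp_apply, hV, mul_pow]
    exact hS.mul_left _
  have := (isPosTraceClass_comp_adjoint hs).2
  rw [← this, ContinuousLinearMap.adjoint_comp]
  conv_lhs => rw [hρ]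
  rfl

theorem trace_zero : trace (0 : E →L[ℂ] E) = 0 := by simp [trace]

theorem IsPosTraceClass.eq_zero_of_trace_eq_zero {ρ : E →L[ℂ] E} (h : IsPosTraceClass ρ)
    (h0 : (trace ρ).re = 0) : ρ = 0 := by
  obtain ⟨S, hρ, hS⟩ := h.exists_sqrt
  rw [h0, hasSum_zero_iff_of_nonneg fun _ => by positivity] at hS
  have hz : S = 0 := by
    refine ContinuousLinearMap.ext_on (s := Set.range (stdBasis E)) ?_ ?_
    · rw [Submodule.dense_iff_topologicalClosure_eq_top]
      exact (stdBasis E).dense_span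
    · rintro _ ⟨i, rfl⟩
      simpa using congrFun hS i
  rw [hρ, hz, ContinuousLinearMap.zero_comp]

theorem IsDensity.trace_re_ne_zero {ρ : E →L[ℂ] E} (h : IsDensity ρ) : (trace ρ).re ≠ 0 :=
  fun h0 => h.ne_zero (h.isPosTraceClass.eq_zero_of_trace_eq_zero h0)

omit [CompleteSpace E] in
/-- Parseval's identity. -/
theorem hasSum_inner_rankOne {ι : Type*} (e : HilbertBasis ι ℂ E) (b : E) :
    HasSum (fun i => inner ℂ (e i) (InnerProductSpace.rankOne ℂ b b (e i)))
      ((‖b‖ ^ 2 : ℝ) : ℂ) := by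
  have h := e.hasSum_inner_mul_inner b b
  rw [inner_self_eq_norm_sq_to_K] at h
  simpa [inner_smul_right] using h

theorem trace_rankOne (b : E) :
    trace (InnerProductSpace.rankOne ℂ b b) = ((‖b‖ ^ 2 : ℝ) : ℂ) :=
  (hasSum_inner_rankOne (stdBasis E) b).tsum_eq

theorem isDensity_rankOne {ψ : E} (hψ : ψ ≠ 0) : IsDensity (InnerProductSpace.rankOne ℂ ψ ψ) :=
  ⟨InnerProductSpace.rankOne_ne_zero hψ hψ, InnerProductSpace.isPositive_rankOne_self ψ,
    (hasSum_inner_rankOne (stdBasis E) ψ).summable⟩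

end Trace

/-! ### The probability of a branch -/

/-- The probabilities along a branch telescope. A state of trace zero reached on the way is the zero
operator, so that both sides vanish in that case. -/
theorem Branch.prob_eq {K : Type*} [NormedAddCommGroup K] [InnerProductSpace ℂ K]
    [CompleteSpace K] {T : MTree K} (β : Branch T) {σ : K →L[ℂ] K} (hσ : IsPosTraceClass σ)
    (h0 : (trace σ).re ≠ 0) :
    β.prob σ = (trace (β.cumOp ∘L σ ∘L β.cumOp.adjoint)).re / (trace σ).re := by
  induction β generalizing σ with
  | nil =>
    rw [Branch.prob, Branch.cumOp, ContinuousLinearMap.id_comp,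
      ContinuousLinearMap.adjoint_id, ContinuousLinearMap.comp_id, div_self h0]
  | @cons M child o β ih =>
    have hC : (Branch.cons (M := M) (child := child) o β).cumOp ∘L σ ∘L
        (Branch.cons (M := M) (child := child) o β).cumOp.adjoint =
        β.cumOp ∘L M.post o σ ∘L β.cumOp.adjoint := by
      rw [Branch.cumOp, ContinuousLinearMap.adjoint_comp]
      rfl
    rw [hC, Branch.prob, Measurement.prob]
    have hpost : IsPosTraceClass (M.post o σ) := hσ.conj (M.op o)
    by_cases hz : (trace (M.post o σ)).re = 0
    · rw [hpost.eq_zero_of_trace_eq_zero hz]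
      simp [trace_zero]
    · rw [ih hpost hz]
      field_simp

/-! ### Computing a unitary along a branch -/

/-- If all vectors `(1 ⊗ ⟨f j|) D ψ` lie on the line of `U ψ`, then `D` is `U` followed by `x ↦ x ⊗ b`
for a fixed `b`: each `U† (1 ⊗ ⟨f j|) D` has every vector as an eigenvector, so it is a scalar,
the coordinate of `b` at `f j`. -/
theorem exists_eq_tensorKet_comp {H A : Type*} [NormedAddCommGroup H]
    [InnerProductSpace ℂ H] [CompleteSpace H] [Nontrivial H] [NormedAddCommGroup A]
    [InnerProductSpace ℂ A] [CompleteSpace A] {U : H →L[ℂ] H} (hU : U.adjoint ∘L U = 1)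
    {ι : Type*} (f : HilbertBasis ι ℂ A) (D : H →L[ℂ] HTensor H A)
    (hD : ∀ ψ j, (tensorKet H (f j)).adjoint (D ψ) ∈ Submodule.span ℂ {U ψ}) :
    ∃ b : A, D = tensorKet H b ∘L U := by
  have hUU (x : H) : U.adjoint (U x) = x := congrArg (fun S : H →L[ℂ] H => S x) hU
  have hlam (j) : ∃ c : ℂ, ∀ ψ, (tensorKet H (f j)).adjoint (D ψ) = c • U ψ := by
    obtain ⟨c, hc⟩ := LinearMap.exists_eq_smul_id_of_forall_notLinearIndependent
      (f := (U.adjoint ∘L (tensorKet H (f j)).adjoint ∘L D).toLinearMap) fun ψ hli => by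
        obtain ⟨m, hm⟩ := Submodule.mem_span_singleton.1 (hD ψ j)
        have := (LinearIndependent.pair_iff.1 hli) m (-1) (by simp [← hm, hUU])
        simp at this
    refine ⟨c, fun ψ => ?_⟩
    obtain ⟨m, hm⟩ := Submodule.mem_span_singleton.1 (hD ψ j)
    have hψ : m • ψ = c • ψ := by
      have := LinearMap.congr_fun hc ψ
      simpa [← hm, hUU] using this
    rw [← hm, ← map_smul, hψ, map_smul]
  choose c hc using hlam
  obtain ⟨e, he⟩ := exists_norm_eq H zero_le_one
  -- The vector `b` is read off from `D e = U e ⊗ b` by contracting with the unit vector `U e`.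
  have hUe : ‖U e‖ = 1 := by
    rw [← he, ← sq_eq_sq₀ (norm_nonneg _) (norm_nonneg _)]
    apply Complex.ofReal_injective
    have := ContinuousLinearMap.adjoint_inner_right U e (U e)
    rw [hUU, inner_self_eq_norm_sq_to_K, inner_self_eq_norm_sq_to_K] at this
    simpa using this.symm
  let L (x : H) : A →L[ℂ] HTensor H A :=
    UniformSpace.Completion.toComplL ∘L TensorProduct.mkL ℂ H A x
  have hL (x : H) (y : A) : L x y = tensorKet H y x := rfl
  refine ⟨(L (U e)).adjoint (D e), ContinuousLinearMap.ext fun ψ => ext_inner_tensorKet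
    fun x y => ?_⟩
  have hb (j) : inner ℂ (f j) ((L (U e)).adjoint (D e)) = c j := by
    rw [ContinuousLinearMap.adjoint_inner_right, hL, ← ContinuousLinearMap.adjoint_inner_right,
      hc, inner_smul_right, inner_self_eq_norm_sq_to_K, hUe]
    simp
  -- It suffices to compare both sides on `x ⊗ f j`, where the coordinates `c j` of `b` appear.
  have key : innerSL ℂ (D ψ) ∘L L x =
      innerSL ℂ (tensorKet H ((L (U e)).adjoint (D e)) (U ψ)) ∘L L x := by
    refine ContinuousLinearMap.ext_on (s := Set.range f) ?_ ?_
    · rw [Submodule.dense_iff_topologicalClosure_eq_top]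
      exact f.dense_span
    · rintro _ ⟨j, rfl⟩
      simp only [ContinuousLinearMap.comp_apply, innerSL_apply_apply, hL]
      rw [inner_tensorKet, ← inner_conj_symm _ (f j), hb, ← ContinuousLinearMap.adjoint_inner_left,
        hc, inner_smul_left, mul_comm]
  exact congrArg (fun S : A →L[ℂ] ℂ => S y) key

end MeasurementTree

open MeasurementTree in
theorem theorem4p1
    {H : Type*} [NormedAddCommGroup H] [InnerProductSpace ℂ H] [CompleteSpace H]
    [TopologicalSpace.SeparableSpace H]
    {A : Type*} [NormedAddCommGroup A] [InnerProductSpace ℂ A] [CompleteSpace A]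
    [TopologicalSpace.SeparableSpace A]
    (hdim : 2 ≤ Module.rank ℂ H)
    (a : A) (ha : ‖a‖ = 1)
    (U : H →L[ℂ] H) (hU : U ∈ unitary (H →L[ℂ] H))
    (T : MTree (HTensor H A)) (hT : IsMeasTree T) (β : Branch T)
    (hβ : ∀ ρ : H →L[ℂ] H, IsDensity ρ → IsPure ρ → ComputesAlong β a U ρ) :
    ∃ b : A,
      (∀ ρ : H →L[ℂ] H, IsDensity ρ →
        β.cumOp ∘L fullInput a ρ ∘L β.cumOp.adjoint =
          opTensor (U ∘L ρ ∘L U.adjoint) (InnerProductSpace.rankOne ℂ b b)) ∧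
      trace (InnerProductSpace.rankOne ℂ b b) = ((‖b‖ ^ 2 : ℝ) : ℂ) ∧
      (∀ ρ : H →L[ℂ] H, IsDensity ρ → β.prob (fullInput a ρ) = ‖b‖ ^ 2) ∧
      ((∃ ρ : H →L[ℂ] H, IsDensity ρ ∧ β.Attainable (fullInput a ρ)) →
        ∀ ρ : H →L[ℂ] H, IsDensity ρ → β.Attainable (fullInput a ρ)) := by
  have : Nontrivial H := rank_pos_iff_nontrivial.1 (two_pos.trans_le hdim)
  have hUU : U.adjoint ∘L U = 1 := Unitary.star_mul_self_of_mem hU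
  -- The operator `ψ ↦ C (ψ ⊗ a)`.
  set D : H →L[ℂ] HTensor H A := β.cumOp ∘L tensorKet H a with hDdef
  have hfull (ρ : H →L[ℂ] H) :
      β.cumOp ∘L fullInput a ρ ∘L β.cumOp.adjoint = D ∘L ρ ∘L D.adjoint := by
    rw [fullInput, opTensor_rankOne, hDdef, ContinuousLinearMap.adjoint_comp]
    rfl
  obtain ⟨b, hb⟩ := exists_eq_tensorKet_comp hUU (stdBasis A) D fun ψ j => by
    rcases eq_or_ne ψ 0 with rfl | hψ
    · simp
    obtain ⟨c, hc⟩ := hβ _ (isDensity_rankOne hψ) ⟨ψ, hψ, rfl⟩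
    simp only [hfull, InnerProductSpace.rankOne_comp, InnerProductSpace.comp_rankOne,
      ContinuousLinearMap.adjoint_adjoint] at hc
    have hsum := hasSum_partialTrace_rankOne (D ψ)
    rw [hc] at hsum
    exact mem_span_of_hasSum_rankOne hsum j
  have hprob (ρ : H →L[ℂ] H) (hρ : IsDensity ρ) : β.prob (fullInput a ρ) = ‖b‖ ^ 2 := by
    have hin : fullInput a ρ = tensorKet H a ∘L ρ ∘L (tensorKet H a).adjoint :=
      opTensor_rankOne ρ a
    have htr : trace (fullInput a ρ) = (((trace ρ).re : ℝ) : ℂ) := by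
      rw [hin, hρ.isPosTraceClass.trace_conj (t := 1) fun x => by rw [norm_tensorKet, ha]; ring]
      norm_num
    have hUn (x : H) : ‖U x‖ = ‖x‖ := U.norm_map_of_mem_unitary hU x
    rw [β.prob_eq (hin ▸ hρ.isPosTraceClass.conj _)
        (by rw [htr]; exact hρ.trace_re_ne_zero), hfull,
      hρ.isPosTraceClass.trace_conj (t := ‖b‖) fun x => by
        rw [hb, ContinuousLinearMap.comp_apply, norm_tensorKet, hUn, mul_comm],
      htr, Complex.ofReal_re, Complex.ofReal_re, mul_div_cancel_right₀ _ hρ.trace_re_ne_zero]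
  refine ⟨b, fun ρ _ => ?_, trace_rankOne b, hprob, ?_⟩
  · rw [hfull, hb, opTensor_rankOne, ContinuousLinearMap.adjoint_comp]
    rfl
  · rintro ⟨ρ', hρ', hatt⟩ ρ hρ
    rw [Branch.Attainable, hprob _ hρ'] at hatt
    rwa [Branch.Attainable, hprob _ hρ]
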